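/- Theorem 1.2. For elements $x,y$ of a group write ${}^xy=xyx^{-1}$ and $[x,y]=xyx^{-1}y^{-1}$. For a group $G$ (possibly infinite), let $G\curlywedge G$ be the group generated by the symbols $m\curlywedge n$ ($m,n\in G$) subject to the relations $$mm'\curlywedge n=({}^mm'\curlywedge{}^mn)(m\curlywedge n),\qquad m\curlywedge nn'=(m\curlywedge n)({}^nm\curlywedge{}^nn'),\qquad x\curlywedge y=1,$$ for all $m,m',n,n'\in G$ and all $x,y\in G$ with $[x,y]=1$. Let $\tilde{\mathrm B}_0(G)$ be the kernel of the homomorphism $G\curlywedge G\to[G,G]$ that sends $x\curlywedge y$ to $[x,y]$ for all $x,y\in G$. For a finite group $G$, let $\mathrm B_0(G)$ be the Bogomolov multiplier of $G$, $$\mathrm B_0(G)=\bigcap_{A\le G,\ A\text{ abelian}}\ker\bigl(\mathrm{res}^G_A:\mathrm H^2(G,\mathbb Q/\mathbb Z)\to\mathrm H^2(A,\mathbb Q/\mathbb Z)\bigr),$$ where the groups act trivially on $\mathbb Q/\mathbb Z$ and $\mathrm{res}^G_A$ is the cohomological restriction map. Let $G_1$ and $G_2$ be isoclinic groups (possibly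 infinite), that is, suppose that there are isomorphisms $\alpha:G_1/Z(G_1)\to G_2/Z(G_2)$ and $\beta:[G_1,G_1]\to[G_2,G_2]$ such that $\beta([a_1,b_1])=[a_2,b_2]$ for all $a_1,b_1\in G_1$ and $a_2,b_2\in G_2$ with $\alpha(a_1Z(G_1))=a_2Z(G_2)$ and $\alpha(b_1Z(G_1))=b_2Z(G_2)$. Then $\tilde{\mathrm B}_0(G_1)\cong\tilde{\mathrm B}_0(G_2)$. In particular, if $G_1$ and $G_2$ are finite, then $\mathrm B_0(G_1)\cong\mathrm B_0(G_2)$. -/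

import Mathlib

universe u v

open scoped commutatorElement

/-! ### The group `G ⋏ G` and the group `B̃₀(G)`

Throughout, `⁅x, y⁆ = x * y * x⁻¹ * y⁻¹`, and the conjugate `ˣy` is `x * y * x⁻¹`. -/

/-- The defining relations of `G ⋏ G`, as words in the free group on the symbols `m ⋏ n`,
that is, on the pairs `(m, n)`; the relation `l = r` is the word `l * r⁻¹`. -/
inductive CurlyRel (G : Type u) [Group G] : FreeGroup (G × G) → Prop
  /-- `m m' ⋏ n = (ᵐm' ⋏ ᵐn) (m ⋏ n)` -/
  | mul_left (m m' n : G) : CurlyRel G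
      (FreeGroup.of (m * m', n) *
        (FreeGroup.of (m * m' * m⁻¹, m * n * m⁻¹) * FreeGroup.of (m, n))⁻¹)
  /-- `m ⋏ n n' = (m ⋏ n) (ⁿm ⋏ ⁿn')` -/
  | mul_right (m n n' : G) : CurlyRel G
      (FreeGroup.of (m, n * n') *
        (FreeGroup.of (m, n) * FreeGroup.of (n * m * n⁻¹, n * n' * n⁻¹))⁻¹)
  /-- `x ⋏ y = 1` whenever `x` and `y` commute -/
  | comm (x y : G) (h : ⁅x, y⁆ = 1) : CurlyRel G (FreeGroup.of (x, y))

/-- The group `G ⋏ G`, given by generators and relations. -/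
abbrev CurlySquare (G : Type u) [Group G] : Type u :=
  PresentedGroup {r : FreeGroup (G × G) | CurlyRel G r}

/-- The generator `m ⋏ n` of `G ⋏ G`. -/
def curly {G : Type u} [Group G] (m n : G) : CurlySquare G :=
  PresentedGroup.of (m, n)

/-- The commutator `⁅x, y⁆` as an element of the derived subgroup `[G, G]`. -/
def derivedComm {G : Type u} [Group G] (x y : G) : commutator G :=
  ⟨⁅x, y⁆, Subgroup.commutator_mem_commutator (Subgroup.mem_top x) (Subgroup.mem_top y)⟩

theorem derivedComm_rel (G : Type u) [Group G] (r : FreeGroup (G × G)) (hr : CurlyRel G r) :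
    FreeGroup.lift (fun p : G × G => derivedComm p.1 p.2) r = 1 := by
  apply Subtype.ext
  cases hr with
  | mul_left m m' n => simp [derivedComm, commutatorElement_def, mul_assoc]
  | mul_right m n n' => simp [derivedComm, commutatorElement_def, mul_assoc]
  | comm x y h => simpa [derivedComm] using h

/-- The commutator map `κ : G ⋏ G → [G, G]`, `m ⋏ n ↦ [m, n]`. -/
def curlyCommutator (G : Type u) [Group G] : CurlySquare G →* commutator G :=
  PresentedGroup.toGroup (f := fun p : G × G => derivedComm p.1 p.2) (derivedComm_rel G)

theorem curlyCommutator_curly {G : Type u} [Group G] (m n : G) :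
    (curlyCommutator G (curly m n) : G) = ⁅m, n⁆ := by
  simp [curlyCommutator, curly, derivedComm]

/-- The group `B̃₀(G)`: the kernel of the commutator map `κ : G ⋏ G → [G, G]`. -/
def bogomolovTilde (G : Type u) [Group G] : Subgroup (CurlySquare G) :=
  (curlyCommutator G).ker

/-! ### The Bogomolov multiplier -/

/-- The trivial `G`-module `ℚ/ℤ` (lifted, with the base ring `ℤ`, to the universe of `G`, as
`groupCohomology` requires). -/
noncomputable def ratModInt (G : Type u) [Group G] : Rep.{u} (ULift.{u} ℤ) G :=
  Rep.trivial (ULift.{u} ℤ) G (ULift.{u} (AddCircle (1 : ℚ)))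

/-- The restriction map `res : H²(G, ℚ/ℤ) → H²(A, ℚ/ℤ)` to a subgroup `A` of `G`. -/
noncomputable def resH2 (G : Type u) [Group G] (A : Subgroup G) :
    groupCohomology (ratModInt G) 2 →ₗ[ULift.{u} ℤ]
      groupCohomology (Rep.res A.subtype (ratModInt G)) 2 :=
  (groupCohomology.map A.subtype
    (CategoryTheory.CategoryStruct.id (Rep.res A.subtype (ratModInt G))) 2).hom

/-- The Bogomolov multiplier `B₀(G)`: the intersection, over all abelian subgroups `A` of `G`, of
the kernels of the restriction maps `H²(G, ℚ/ℤ) → H²(A, ℚ/ℤ)`. -/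
noncomputable def bogomolovMultiplier (G : Type u) [Group G] :
    Submodule (ULift.{u} ℤ) (groupCohomology (ratModInt G) 2) :=
  ⨅ (A : Subgroup G) (_ : IsMulCommutative A), LinearMap.ker (resH2 G A)

/-! ### Isoclinism -/

/-- Two groups are isoclinic (P. Hall) if there are isomorphisms `α : G₁/Z(G₁) ≃ G₂/Z(G₂)` and
`β : [G₁, G₁] ≃ [G₂, G₂]` such that `β [a₁, b₁] = [a₂, b₂]` whenever `α (a₁ Z(G₁)) = a₂ Z(G₂)` and
`α (b₁ Z(G₁)) = b₂ Z(G₂)`. -/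
def Isoclinic (G₁ : Type u) (G₂ : Type v) [Group G₁] [Group G₂] : Prop :=
  ∃ (α : G₁ ⧸ Subgroup.center G₁ ≃* G₂ ⧸ Subgroup.center G₂)
    (β : commutator G₁ ≃* commutator G₂),
    ∀ (a₁ b₁ : G₁) (a₂ b₂ : G₂),
      α (a₁ : G₁ ⧸ Subgroup.center G₁) = (a₂ : G₂ ⧸ Subgroup.center G₂) →
      α (b₁ : G₁ ⧸ Subgroup.center G₁) = (b₂ : G₂ ⧸ Subgroup.center G₂) →
      β (derivedComm a₁ b₁) = derivedComm a₂ b₂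

/-! A central factor can be dropped from either argument of `m ⋏ n`, since symbols of commuting
pairs are trivial. So `m ⋏ n` depends only on classes modulo the centre, and `α` induces an
isomorphism of the groups `G ⋏ G` that carries one commutator map to the other through `β`; their
kernels then correspond (`IsIsoclinism.exists_curlyEquiv`).

For `B₀`, a class dies on every abelian subgroup exactly when its cocycles are symmetric on
commuting pairs, because a symmetric cocycle of an abelian group with values in the divisible group
`ℚ/ℤ` is a coboundary (`exists_coboundary_of_symmetric`). If `π : P → G` is onto and `ker π ∩ [P, P]
= 1`, inflation is an isomorphism on such classes (`nonempty_bogomolovClasses_addEquiv`). Isoclinic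
groups are both quotients of this kind of one group, their fibre product over `α`. -/

open scoped commutatorElement IsMulCommutative

/-! ### The symbols `m ⋏ n` modulo the centre -/

section Curly

variable {G : Type u} [Group G]

theorem curly_mul_left (m m' n : G) :
    curly (m * m') n = curly (m * m' * m⁻¹) (m * n * m⁻¹) * curly m n := by
  have h := PresentedGroup.one_of_mem (rels := {r : FreeGroup (G × G) | CurlyRel G r})
    (CurlyRel.mul_left m m' n)
  rw [map_mul, map_inv, mul_inv_eq_one] at h
  simpa [curly, PresentedGroup.of] using h

theorem curly_mul_right (m n n' : G) :
    curly m (n * n') = curly m n * curly (n * m * n⁻¹) (n * n' * n⁻¹) := by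
  have h := PresentedGroup.one_of_mem (rels := {r : FreeGroup (G × G) | CurlyRel G r})
    (CurlyRel.mul_right m n n')
  rw [map_mul, map_inv, mul_inv_eq_one] at h
  simpa [curly, PresentedGroup.of] using h

theorem curly_eq_one_of_commute {x y : G} (h : Commute x y) : curly x y = 1 :=
  PresentedGroup.one_of_mem (rels := {r : FreeGroup (G × G) | CurlyRel G r})
    (CurlyRel.comm x y (commutatorElement_eq_one_iff_commute.2 h))

theorem curly_mul_center_left (m n : G) {z : G} (hz : z ∈ Subgroup.center G) :
    curly (m * z) n = curly m n := by
  have h : m * z * m⁻¹ = z := by rw [Subgroup.mem_center_iff.1 hz m, mul_inv_cancel_right]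
  rw [curly_mul_left, h,
    curly_eq_one_of_commute (Subgroup.mem_center_iff.1 hz (m * n * m⁻¹)).symm, one_mul]

theorem curly_mul_center_right (m n : G) {z : G} (hz : z ∈ Subgroup.center G) :
    curly m (n * z) = curly m n := by
  have h : n * z * n⁻¹ = z := by rw [Subgroup.mem_center_iff.1 hz n, mul_inv_cancel_right]
  rw [curly_mul_right, h,
    curly_eq_one_of_commute (Subgroup.mem_center_iff.1 hz (n * m * n⁻¹)), mul_one]

theorem curly_congr {m m' n n' : G}
    (hm : (m : G ⧸ Subgroup.center G) = m') (hn : (n : G ⧸ Subgroup.center G) = n') :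
    curly m n = curly m' n' := by
  rw [← mul_inv_cancel_left m m', ← mul_inv_cancel_left n n',
    curly_mul_center_left _ _ (QuotientGroup.eq.1 hm),
    curly_mul_center_right _ _ (QuotientGroup.eq.1 hn)]

theorem CurlySquare.hom_ext {H : Type v} [Group H] {f g : CurlySquare G →* H}
    (h : ∀ m n, f (curly m n) = g (curly m n)) : f = g :=
  PresentedGroup.ext fun p => h p.1 p.2

end Curly

/-! ### Isoclinism and `B̃₀` -/

section IsoclinicCurly

variable {G₁ : Type u} {G₂ : Type v} [Group G₁] [Group G₂]

/-- The condition that relates the two isomorphisms of an isoclinism. -/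
def IsIsoclinism (α : G₁ ⧸ Subgroup.center G₁ ≃* G₂ ⧸ Subgroup.center G₂)
    (β : commutator G₁ ≃* commutator G₂) : Prop :=
  ∀ (a₁ b₁ : G₁) (a₂ b₂ : G₂),
    α (a₁ : G₁ ⧸ Subgroup.center G₁) = (a₂ : G₂ ⧸ Subgroup.center G₂) →
    α (b₁ : G₁ ⧸ Subgroup.center G₁) = (b₂ : G₂ ⧸ Subgroup.center G₂) →
    β (derivedComm a₁ b₁) = derivedComm a₂ b₂

theorem IsIsoclinism.symm {α : G₁ ⧸ Subgroup.center G₁ ≃* G₂ ⧸ Subgroup.center G₂}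
    {β : commutator G₁ ≃* commutator G₂} (h : IsIsoclinism α β) :
    IsIsoclinism α.symm β.symm := fun a₂ b₂ a₁ b₁ ha hb => by
  rw [MulEquiv.symm_apply_eq] at ha hb ⊢
  exact (h a₁ b₁ a₂ b₂ ha.symm hb.symm).symm

theorem IsIsoclinism.commutatorElement_eq_one
    {α : G₁ ⧸ Subgroup.center G₁ ≃* G₂ ⧸ Subgroup.center G₂}
    {β : commutator G₁ ≃* commutator G₂} (h : IsIsoclinism α β) {a₁ b₁ : G₁} {a₂ b₂ : G₂}
    (ha : α a₁ = a₂) (hb : α b₁ = b₂) (h₁ : ⁅a₁, b₁⁆ = 1) : ⁅a₂, b₂⁆ = 1 := by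
  have h₁' : derivedComm a₁ b₁ = 1 := Subtype.ext h₁
  have := h a₁ b₁ a₂ b₂ ha hb
  rw [h₁', map_one] at this
  exact congrArg Subtype.val this.symm

/-- A lift `t` of `α` is multiplicative only modulo the centre, which `curly_congr` absorbs. The
compatibility with `β` ensures that commuting pairs go to commuting pairs. -/
theorem IsIsoclinism.exists_curlyHom
    {α : G₁ ⧸ Subgroup.center G₁ ≃* G₂ ⧸ Subgroup.center G₂}
    {β : commutator G₁ ≃* commutator G₂} (h : IsIsoclinism α β) :
    ∃ f : CurlySquare G₁ →* CurlySquare G₂, ∀ (a₁ b₁ : G₁) (a₂ b₂ : G₂),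
      α a₁ = a₂ → α b₁ = b₂ → f (curly a₁ b₁) = curly a₂ b₂ := by
  choose t ht using fun a : G₁ => QuotientGroup.mk_surjective (α a)
  have hmul (a b : G₁) : ((t (a * b) : G₂) : G₂ ⧸ Subgroup.center G₂) = (t a * t b : G₂) := by
    simp [ht]
  have hconj (a b : G₁) :
      ((t (a * b * a⁻¹) : G₂) : G₂ ⧸ Subgroup.center G₂) = (t a * t b * (t a)⁻¹ : G₂) := by
    simp [ht]
  have hrel : ∀ r ∈ {r : FreeGroup (G₁ × G₁) | CurlyRel G₁ r},
      FreeGroup.lift (fun p : G₁ × G₁ => curly (t p.1) (t p.2)) r = 1 := by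
    rintro r (⟨m, m', n⟩ | ⟨m, n, n'⟩ | ⟨x, y, hxy⟩)
    · simp only [map_mul, map_inv, FreeGroup.lift_apply_of, mul_inv_eq_one]
      rw [curly_congr (hmul m m') rfl, curly_mul_left, curly_congr (hconj m m') (hconj m n)]
    · simp only [map_mul, map_inv, FreeGroup.lift_apply_of, mul_inv_eq_one]
      rw [curly_congr rfl (hmul n n'), curly_mul_right, curly_congr (hconj n m) (hconj n n')]
    · rw [FreeGroup.lift_apply_of]
      exact curly_eq_one_of_commute (commutatorElement_eq_one_iff_commute.1
        (h.commutatorElement_eq_one (ht x).symm (ht y).symm hxy))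
  refine ⟨PresentedGroup.toGroup hrel, fun a₁ b₁ a₂ b₂ ha hb => ?_⟩
  rw [curly, PresentedGroup.toGroup.of]
  exact curly_congr ((ht a₁).trans ha) ((ht b₁).trans hb)

theorem IsIsoclinism.exists_curlyEquiv
    {α : G₁ ⧸ Subgroup.center G₁ ≃* G₂ ⧸ Subgroup.center G₂}
    {β : commutator G₁ ≃* commutator G₂} (h : IsIsoclinism α β) :
    ∃ e : CurlySquare G₁ ≃* CurlySquare G₂,
      ∀ x, curlyCommutator G₂ (e x) = β (curlyCommutator G₁ x) := by
  obtain ⟨f, hf⟩ := h.exists_curlyHom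
  obtain ⟨g, hg⟩ := h.symm.exists_curlyHom
  choose t ht using fun a : G₁ => QuotientGroup.mk_surjective (α a)
  choose s hs using fun a : G₂ => QuotientGroup.mk_surjective (α.symm a)
  have hgf : g.comp f = MonoidHom.id _ := CurlySquare.hom_ext fun m n => by
    rw [MonoidHom.comp_apply, hf m n _ _ (ht m).symm (ht n).symm, MonoidHom.id_apply]
    exact hg _ _ _ _ (by simp [ht]) (by simp [ht])
  have hfg : f.comp g = MonoidHom.id _ := CurlySquare.hom_ext fun m n => by
    rw [MonoidHom.comp_apply, hg m n _ _ (hs m).symm (hs n).symm, MonoidHom.id_apply]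
    exact hf _ _ _ _ (by simp [hs]) (by simp [hs])
  have hκ : (curlyCommutator G₂).comp f = β.toMonoidHom.comp (curlyCommutator G₁) :=
    CurlySquare.hom_ext fun m n => by
      have h₁ : curlyCommutator G₁ (curly m n) = derivedComm m n :=
        Subtype.ext (curlyCommutator_curly m n)
      have h₂ : curlyCommutator G₂ (curly (t m) (t n)) = derivedComm (t m) (t n) :=
        Subtype.ext (curlyCommutator_curly _ _)
      rw [MonoidHom.comp_apply, hf m n _ _ (ht m).symm (ht n).symm, h₂, MonoidHom.comp_apply, h₁]
      exact (h m n _ _ (ht m).symm (ht n).symm).symm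
  exact ⟨f.toMulEquiv g hgf hfg, fun x => DFunLike.congr_fun hκ x⟩

theorem IsIsoclinism.nonempty_bogomolovTilde_mulEquiv
    {α : G₁ ⧸ Subgroup.center G₁ ≃* G₂ ⧸ Subgroup.center G₂}
    {β : commutator G₁ ≃* commutator G₂} (h : IsIsoclinism α β) :
    Nonempty (bogomolovTilde G₁ ≃* bogomolovTilde G₂) := by
  obtain ⟨e, he⟩ := h.exists_curlyEquiv
  have hmap : (bogomolovTilde G₁).map e.toMonoidHom = bogomolovTilde G₂ := by
    ext y
    rw [Subgroup.mem_map_equiv]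
    obtain ⟨x, rfl⟩ := e.surjective y
    simp [bogomolovTilde, MonoidHom.mem_ker, he]
  exact ⟨(e.subgroupMap (bogomolovTilde G₁)).trans (MulEquiv.subgroupCongr hmap)⟩

end IsoclinicCurly

/-! ### Divisibility of `ℚ/ℤ` and symmetric cocycles -/

theorem exists_character_extension {A : Type u} {B : Type v} [AddCommGroup A] [AddCommGroup B]
    (f : A →+ B) (hf : Function.Injective f) (χ : A →+ AddCircle (1 : ℚ)) :
    ∃ χ' : B →+ AddCircle (1 : ℚ), ∀ a, χ' (f a) = χ a := by
  obtain ⟨χ', h⟩ := CharacterModule.dual_surjective_of_injective f.toIntLinearMap hf χ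
  exact ⟨χ', fun a => DFunLike.congr_fun h a⟩

section Cocycles

variable (G : Type u) [Group G]

/-- The `2`-cocycles of `G` with values in the trivial module `ℚ/ℤ` that are symmetric on
commuting pairs. -/
def bogomolovCocycles : AddSubgroup (G → G → AddCircle (1 : ℚ)) where
  carrier := {c | (∀ g h j, c (g * h) j + c g h = c h j + c g (h * j)) ∧
    ∀ g h, Commute g h → c g h = c h g}
  add_mem' {a b} ha hb := by
    refine ⟨fun g h j => ?_, fun g h hgh => ?_⟩
    · simp only [Pi.add_apply]
      rw [add_add_add_comm, ha.1, hb.1, add_add_add_comm]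
    · simp only [Pi.add_apply, ha.2 g h hgh, hb.2 g h hgh]
  zero_mem' := by simp
  neg_mem' {a} ha := by
    refine ⟨fun g h j => ?_, fun g h hgh => ?_⟩
    · simp only [Pi.neg_apply]
      rw [← neg_add, ha.1, neg_add]
    · simp only [Pi.neg_apply, ha.2 g h hgh]

/-- The coboundary of a `1`-cochain of `G` with values in the trivial module `ℚ/ℤ`. -/
def characterCoboundary :
    (G → AddCircle (1 : ℚ)) →+ (G → G → AddCircle (1 : ℚ)) where
  toFun f g h := f h - f (g * h) + f g
  map_zero' := by ext; simp
  map_add' a b := by ext g h; simp only [Pi.add_apply]; abel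

theorem characterCoboundary_mem (f : G → AddCircle (1 : ℚ)) :
    characterCoboundary G f ∈ bogomolovCocycles G := by
  refine ⟨fun g h j => ?_, fun g h hgh => ?_⟩
  · simp only [characterCoboundary, AddMonoidHom.coe_mk, ZeroHom.coe_mk, mul_assoc]
    abel
  · simp only [characterCoboundary, AddMonoidHom.coe_mk, ZeroHom.coe_mk, hgh.eq]
    abel

/-- Classes of `2`-cocycles with values in `ℚ/ℤ` that are symmetric on commuting pairs. -/
abbrev BogomolovClasses : Type u :=
  bogomolovCocycles G ⧸ (characterCoboundary G).range.addSubgroupOf (bogomolovCocycles G)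

end Cocycles

section SymmetricCocycle

variable {A : Type u} [CommGroup A]

/-- The extension of a commutative group by `ℚ/ℤ` given by a symmetric `2`-cocycle, normalized so
that `(0, 1)` is neutral. -/
abbrev symmetricExtension (c : A → A → AddCircle (1 : ℚ))
    (hc : ∀ g h j, c (g * h) j + c g h = c h j + c g (h * j)) (hs : ∀ g h, c g h = c h g) :
    AddCommGroup (AddCircle (1 : ℚ) × A) :=
  have h1 : ∀ a, c 1 a = c 1 1 := fun a => by simpa using (hc 1 1 a).symm
  letI : Zero (AddCircle (1 : ℚ) × A) := ⟨(0, 1)⟩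
  letI : Add (AddCircle (1 : ℚ) × A) :=
    ⟨fun x y => (x.1 + y.1 + (c x.2 y.2 - c 1 1), x.2 * y.2)⟩
  letI : Neg (AddCircle (1 : ℚ) × A) := ⟨fun x => (-x.1 - (c x.2⁻¹ x.2 - c 1 1), x.2⁻¹)⟩
  { add_assoc := fun x y z => Prod.ext
      (by
        have := hc x.2 y.2 z.2
        change x.1 + y.1 + (c x.2 y.2 - c 1 1) + z.1 + (c (x.2 * y.2) z.2 - c 1 1) =
          x.1 + (y.1 + z.1 + (c y.2 z.2 - c 1 1)) + (c x.2 (y.2 * z.2) - c 1 1)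
        rw [← sub_eq_zero] at this ⊢
        rw [← this]
        abel)
      (mul_assoc _ _ _)
    zero_add := fun x => Prod.ext
      (by change 0 + x.1 + (c 1 x.2 - c 1 1) = x.1; rw [h1]; abel) (one_mul _)
    add_zero := fun x => Prod.ext
      (by change x.1 + 0 + (c x.2 1 - c 1 1) = x.1; rw [hs, h1]; abel) (mul_one _)
    neg_add_cancel := fun x => Prod.ext
      (by
        change -x.1 - (c x.2⁻¹ x.2 - c 1 1) + x.1 + (c x.2⁻¹ x.2 - c 1 1) = 0
        abel)
      (inv_mul_cancel _)
    add_comm := fun x y => Prod.ext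
      (by
        change x.1 + y.1 + (c x.2 y.2 - c 1 1) = y.1 + x.1 + (c y.2 x.2 - c 1 1)
        rw [hs, add_comm x.1])
      (mul_comm _ _)
    nsmul := nsmulRec
    zsmul := zsmulRec }

/-- The extension defined by `c` is abelian, so the identity of `ℚ/ℤ` extends to a retraction `r` of
it; `a ↦ r (0, a)` splits the normalized cocycle. -/
theorem exists_coboundary_of_symmetric (c : A → A → AddCircle (1 : ℚ))
    (hc : ∀ g h j, c (g * h) j + c g h = c h j + c g (h * j)) (hs : ∀ g h, c g h = c h g) :
    ∃ f : A → AddCircle (1 : ℚ), ∀ g h, c g h = f h - f (g * h) + f g := by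
  have h1 : ∀ a, c 1 a = c 1 1 := fun a => by simpa using (hc 1 1 a).symm
  let := symmetricExtension c hc hs
  have hadd (x y : AddCircle (1 : ℚ) × A) :
      x + y = (x.1 + y.1 + (c x.2 y.2 - c 1 1), x.2 * y.2) := rfl
  let ι : AddCircle (1 : ℚ) →+ AddCircle (1 : ℚ) × A :=
    AddMonoidHom.mk' (fun m => (m, 1)) fun m n => by rw [hadd]; simp
  obtain ⟨r, hr⟩ := exists_character_extension ι (fun m n h => congrArg Prod.fst h)
    (AddMonoidHom.id _)
  obtain ⟨ρ, key⟩ : ∃ ρ : A → AddCircle (1 : ℚ),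
      ∀ g h, ρ g + ρ h = c g h - c 1 1 + ρ (g * h) := by
    refine ⟨fun a => r (0, a), fun g h => ?_⟩
    rw [← map_add, ← AddMonoidHom.id_apply _ (c g h - c 1 1), ← hr, ← map_add]
    congr 1
    simp only [hadd, ι, AddMonoidHom.mk'_apply, h1, zero_add, one_mul]
    simp
  -- The coboundary of a constant is that constant, so this undoes the normalization.
  refine ⟨fun a => ρ a + c 1 1, fun g h => ?_⟩
  have := key g h
  beta_reduce
  rw [← sub_eq_zero] at this ⊢
  rw [← neg_eq_zero, ← this]
  abel

end SymmetricCocycle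

/-! ### Inflation along `π` with `ker π ∩ [P, P] = 1` -/

section Inflation

variable {P : Type u} {G : Type v} [Group P] [Group G]

theorem commute_of_map_commute {π : P →* G} (hN : ∀ x ∈ π.ker, x ∈ commutator P → x = 1)
    {p q : P} (h : Commute (π p) (π q)) : Commute p q := by
  rw [← commutatorElement_eq_one_iff_commute] at h ⊢
  exact hN _ (by rw [MonoidHom.mem_ker, map_commutatorElement, h])
    (Subgroup.commutator_mem_commutator (Subgroup.mem_top p) (Subgroup.mem_top q))

/-- The kernel meets `[P, P]` trivially, so it embeds in the abelianization of `P`, and its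
characters extend from there. -/
theorem exists_character_extension_of_ker {π : P →* G}
    (hN : ∀ x ∈ π.ker, x ∈ commutator P → x = 1) (f : P → AddCircle (1 : ℚ))
    (hf : ∀ n ∈ π.ker, ∀ n' ∈ π.ker, f (n * n') = f n + f n') :
    ∃ χ : P → AddCircle (1 : ℚ), (∀ p q, χ (p * q) = χ p + χ q) ∧ ∀ n ∈ π.ker, χ n = f n := by
  have hcomm : IsMulCommutative π.ker := ⟨⟨fun a b => Subtype.ext
    (commute_of_map_commute hN (by rw [a.2]; exact Commute.one_left _))⟩⟩
  have hinj : Function.Injective (Abelianization.of.comp π.ker.subtype) := by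
    rw [injective_iff_map_eq_one]
    intro a ha
    refine Subtype.ext (hN _ a.2 ?_)
    exact (QuotientGroup.eq_one_iff _).1 ha
  obtain ⟨χ, hχ⟩ := exists_character_extension
    (MonoidHom.toAdditive (Abelianization.of.comp π.ker.subtype)) hinj
    (AddMonoidHom.mk' (fun a : Additive π.ker => f a.toMul) fun a b =>
      hf _ a.toMul.2 _ b.toMul.2)
  refine ⟨fun p => χ (Additive.ofMul (Abelianization.of p)), fun p q => ?_, fun n hn => ?_⟩
  · beta_reduce
    rw [map_mul, ofMul_mul, map_add]
  · exact hχ (Additive.ofMul ⟨n, hn⟩)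

/-- Pulling back `2`-cocycles along a homomorphism. -/
def inflateCocycle (π : P →* G) : bogomolovCocycles G →+ bogomolovCocycles P where
  toFun c := ⟨fun p q => c.1 (π p) (π q), fun g h j => by simpa using c.2.1 (π g) (π h) (π j),
    fun g h hgh => c.2.2 _ _ (hgh.map π)⟩
  map_zero' := rfl
  map_add' _ _ := rfl

theorem inflateCocycle_mem_coboundary_iff {π : P →* G} (hπ : Function.Surjective π)
    (hN : ∀ x ∈ π.ker, x ∈ commutator P → x = 1) (c : bogomolovCocycles G) :
    (inflateCocycle π c).1 ∈ (characterCoboundary P).range ↔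
      c.1 ∈ (characterCoboundary G).range := by
  constructor
  · rintro ⟨f, hf⟩
    obtain ⟨c, hc, hs⟩ := c
    have hf (p q : P) : f q - f (p * q) + f p = c (π p) (π q) := congrFun₂ hf p q
    have h1 (g : G) : c g 1 = c 1 1 := by simpa using hc g 1 1
    obtain ⟨χ, hχ, hχf⟩ := exists_character_extension_of_ker hN (fun p => f p - c 1 1) <| by
      intro n hn n' hn'
      have := hf n n'
      rw [hn, hn', ← sub_eq_zero] at this
      rw [← sub_eq_zero, ← neg_eq_zero, ← this]
      abel
    -- Subtracting a character leaves the coboundary of `f` unchanged and makes `f` constant on the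
    -- fibres of `π`.
    have hdesc {p q : P} (h : π p = π q) : f p - χ p = f q - χ q := by
      have hn : p⁻¹ * q ∈ π.ker := by simp [MonoidHom.mem_ker, h]
      have e1 := hf p (p⁻¹ * q)
      have e2 := hχ p (p⁻¹ * q)
      rw [hn, h1, mul_inv_cancel_left] at e1
      rw [hχf _ hn, mul_inv_cancel_left] at e2
      rw [e2, ← sub_eq_zero, ← e1]
      abel
    choose s hs' using hπ
    refine ⟨fun g => f (s g) - χ (s g), funext₂ fun g h => ?_⟩
    change (f (s h) - χ (s h)) - (f (s (g * h)) - χ (s (g * h))) + (f (s g) - χ (s g)) = c g h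
    rw [hdesc (p := s (g * h)) (q := s g * s h) (by simp [hs']), hχ]
    have := hf (s g) (s h)
    rw [hs', hs'] at this
    rw [← this]
    abel
  · rintro ⟨f, hf⟩
    refine ⟨f ∘ π, funext₂ fun p q => ?_⟩
    have := congrFun₂ hf (π p) (π q)
    simpa [characterCoboundary, inflateCocycle] using this

/-- The kernel is central, so `c` is symmetric there and splits by some `ψ`. A section `s` of `π`
spreads `ψ` over the cosets. -/
theorem exists_coboundary_on_ker {π : P →* G} (hπ : Function.Surjective π)
    (hN : ∀ x ∈ π.ker, x ∈ commutator P → x = 1) (c : bogomolovCocycles P) :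
    ∃ f : P → AddCircle (1 : ℚ), ∀ n ∈ π.ker, ∀ p, c.1 n p = f p - f (n * p) + f n := by
  obtain ⟨c, hc, hs⟩ := c
  have hcomm : IsMulCommutative π.ker := ⟨⟨fun a b => Subtype.ext
    (commute_of_map_commute hN (by rw [a.2]; exact Commute.one_left _))⟩⟩
  obtain ⟨ψ, hψ⟩ := exists_coboundary_of_symmetric (A := π.ker) (fun a b => c a b)
    (fun g h j => hc g h j)
    (fun g h => hs _ _ (commute_of_map_commute hN (by rw [g.2]; exact Commute.one_left _)))
  choose s hs' using hπ
  have hmem (p : P) : p * (s (π p))⁻¹ ∈ π.ker := by simp [MonoidHom.mem_ker, hs']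
  let F : P → AddCircle (1 : ℚ) := fun p =>
    ψ ⟨p * (s (π p))⁻¹, hmem p⟩ - c (p * (s (π p))⁻¹) (s (π p))
  -- This is the cocycle identity at `n`, `p * (s (π p))⁻¹`, `s (π p)`.
  have hF (n : π.ker) (p : P) : c n p = F p - F (n * p) + ψ n := by
    have hsp : s (π (n * p)) = s (π p) := by rw [map_mul, n.2, one_mul]
    have e1 := hψ n ⟨p * (s (π p))⁻¹, hmem p⟩
    have e2 := hc n (p * (s (π p))⁻¹) (s (π p))
    have e3 : (⟨n * p * (s (π (n * p)))⁻¹, hmem (n * p)⟩ : π.ker) =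
        n * ⟨p * (s (π p))⁻¹, hmem p⟩ := Subtype.ext (by
      change (n : P) * p * (s (π (n * p)))⁻¹ = n * (p * (s (π p))⁻¹)
      rw [hsp, mul_assoc])
    have e4 : (n : P) * p * (s (π p))⁻¹ = n * (p * (s (π p))⁻¹) := mul_assoc _ _ _
    simp only [F]
    rw [e3, hsp, e4]
    simp only [inv_mul_cancel_right] at e2
    simp only at e1
    rw [e1] at e2
    rw [← sub_eq_zero] at e2 ⊢
    rw [← neg_eq_zero, ← e2]
    abel
  -- The constant makes the cochain agree with `ψ` on the kernel, by `hF` at `p = 1`.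
  refine ⟨fun p => F p + (c 1 1 - F 1), fun n hn p => ?_⟩
  have h1 : c n 1 = c 1 1 := by simpa using hc n 1 1
  have e1 := hF ⟨n, hn⟩ 1
  rw [mul_one, h1] at e1
  refine (hF ⟨n, hn⟩ p).trans ?_
  beta_reduce
  rw [e1]
  abel

/-- After correction by a coboundary the cocycle vanishes when its first argument lies in the
kernel, and by symmetry and centrality also when its second does. The cocycle identity then makes it
constant on fibres. -/
theorem exists_inflateCocycle_sub_mem_coboundary {π : P →* G} (hπ : Function.Surjective π)
    (hN : ∀ x ∈ π.ker, x ∈ commutator P → x = 1) (c : bogomolovCocycles P) :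
    ∃ c' : bogomolovCocycles G,
      c.1 - (inflateCocycle π c').1 ∈ (characterCoboundary P).range := by
  obtain ⟨f, hf⟩ := exists_coboundary_on_ker hπ hN c
  obtain ⟨d, hd⟩ : ∃ d : bogomolovCocycles P, d.1 = c.1 - characterCoboundary P f :=
    ⟨⟨_, sub_mem c.2 (characterCoboundary_mem P f)⟩, rfl⟩
  have hcf : c.1 - d.1 ∈ (characterCoboundary P).range := ⟨f, by rw [hd]; abel⟩
  have hd0 (n : P) (hn : n ∈ π.ker) (p : P) : d.1 n p = 0 := by
    rw [hd, Pi.sub_apply, Pi.sub_apply, hf n hn p]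
    exact sub_self _
  have hd0' (n : P) (hn : n ∈ π.ker) (p : P) : d.1 p n = 0 := by
    rw [d.2.2 p n (commute_of_map_commute hN (by rw [hn]; exact Commute.one_right _)), hd0 n hn]
  have hl {p p' : P} (h : π p = π p') (q : P) : d.1 p q = d.1 p' q := by
    have hn : p * p'⁻¹ ∈ π.ker := by simp [MonoidHom.mem_ker, h]
    simpa [hd0 _ hn] using d.2.1 (p * p'⁻¹) p' q
  have hr {q q' : P} (h : π q = π q') (p : P) : d.1 p q = d.1 p q' := by
    have hn : q'⁻¹ * q ∈ π.ker := by simp [MonoidHom.mem_ker, h]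
    simpa [hd0' _ hn] using (d.2.1 p q' (q'⁻¹ * q)).symm
  choose s hs using hπ
  refine ⟨⟨fun g h => d.1 (s g) (s h), fun g h j => ?_, fun g h hgh => ?_⟩, ?_⟩
  · beta_reduce
    rw [hl (p := s (g * h)) (p' := s g * s h) (by simp [hs]),
      hr (q := s (h * j)) (q' := s h * s j) (by simp [hs])]
    exact d.2.1 _ _ _
  · exact d.2.2 _ _ (commute_of_map_commute hN (by simpa [hs] using hgh))
  · convert hcf using 2
    ext p q
    change d.1 (s (π p)) (s (π q)) = d.1 p q
    rw [hl (hs (π p)), hr (hs (π q))]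

theorem nonempty_bogomolovClasses_addEquiv {π : P →* G} (hπ : Function.Surjective π)
    (hN : ∀ x ∈ π.ker, x ∈ commutator P → x = 1) :
    Nonempty (BogomolovClasses G ≃+ BogomolovClasses P) := by
  let φ := (QuotientAddGroup.mk'
    ((characterCoboundary P).range.addSubgroupOf (bogomolovCocycles P))).comp (inflateCocycle π)
  have hker : (characterCoboundary G).range.addSubgroupOf (bogomolovCocycles G) = φ.ker := by
    ext c
    rw [AddMonoidHom.mem_ker, AddSubgroup.mem_addSubgroupOf, AddMonoidHom.comp_apply,
      QuotientAddGroup.mk'_apply, QuotientAddGroup.eq_zero_iff, AddSubgroup.mem_addSubgroupOf]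
    exact (inflateCocycle_mem_coboundary_iff hπ hN c).symm
  have hsurj : Function.Surjective φ := by
    intro y
    obtain ⟨c, rfl⟩ := QuotientAddGroup.mk_surjective y
    obtain ⟨c', hc'⟩ := exists_inflateCocycle_sub_mem_coboundary hπ hN c
    refine ⟨c', QuotientAddGroup.eq.2 ?_⟩
    rw [AddSubgroup.mem_addSubgroupOf]
    simpa [sub_eq_neg_add] using hc'
  exact ⟨(QuotientAddGroup.quotientAddEquivOfEq hker).trans
    (QuotientAddGroup.quotientKerEquivOfSurjective φ hsurj)⟩

end Inflation

/-! ### `B₀` in terms of cocycles -/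

section Multiplier

variable (G : Type u) [Group G]

theorem mem_cocycles₂_ratModInt_iff (f : G × G → ULift.{u} (AddCircle (1 : ℚ))) :
    f ∈ groupCohomology.cocycles₂ (ratModInt G) ↔
      ∀ g h j, (f (g * h, j)).down + (f (g, h)).down =
        (f (h, j)).down + (f (g, h * j)).down := by
  refine (groupCohomology.mem_cocycles₂_iff (A := ratModInt G) f).trans
    (forall₃_congr fun g h j => ?_)
  exact (ULift.down_injective.eq_iff).symm

/-- The class in `H²(G, ℚ/ℤ)` of a `2`-cocycle that is symmetric on commuting pairs. -/
noncomputable def bogomolovCocycleClass :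
    bogomolovCocycles G →+ groupCohomology (ratModInt G) 2 :=
  (groupCohomology.H2π (ratModInt G)).hom.toAddMonoidHom.comp
    { toFun := fun c => ⟨fun p => ULift.up (c.1 p.1 p.2),
        (mem_cocycles₂_ratModInt_iff G _).2 c.2.1⟩
      map_zero' := rfl
      map_add' := fun _ _ => rfl }

theorem bogomolovCocycleClass_eq_zero_iff (c : bogomolovCocycles G) :
    bogomolovCocycleClass G c = 0 ↔ c.1 ∈ (characterCoboundary G).range := by
  refine (groupCohomology.H2π_eq_zero_iff _).trans ⟨?_, ?_⟩
  · rintro ⟨f, hf⟩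
    exact ⟨fun g => (f g).down, funext₂ fun g h => congrArg ULift.down (congrFun hf (g, h))⟩
  · rintro ⟨f, hf⟩
    exact ⟨fun g => ULift.up (f g), funext fun p => congrArg ULift.up (congrFun₂ hf p.1 p.2)⟩

theorem resH2_H2π_eq_zero_iff (A : Subgroup G)
    (x : groupCohomology.cocycles₂ (ratModInt G)) :
    resH2 G A (groupCohomology.H2π (ratModInt G) x) = 0 ↔
      ∃ f : A → AddCircle (1 : ℚ), ∀ a b : A,
        (show ULift.{u} (AddCircle (1 : ℚ)) from x (a, b)).down = f b - f (a * b) + f a := by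
  have h := groupCohomology.H2π_comp_map_apply A.subtype
    (CategoryTheory.CategoryStruct.id (Rep.res A.subtype (ratModInt G))) x
  refine (Eq.congr_left h).trans ((groupCohomology.H2π_eq_zero_iff _).trans ⟨?_, ?_⟩)
  · rintro ⟨f, hf⟩
    exact ⟨fun g => (f g).down,
      fun a b => (congrArg ULift.down (congrFun hf (a, b))).symm⟩
  · rintro ⟨f, hf⟩
    exact ⟨fun g => ULift.up (f g), funext fun p => congrArg ULift.up (hf p.1 p.2).symm⟩

theorem H2π_mem_bogomolovMultiplier_iff (x : groupCohomology.cocycles₂ (ratModInt G)) :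
    groupCohomology.H2π (ratModInt G) x ∈ bogomolovMultiplier G ↔
      ∀ g h, Commute g h → x (g, h) = x (h, g) := by
  simp only [bogomolovMultiplier, Submodule.mem_iInf, LinearMap.mem_ker]
  constructor
  · intro H g h hgh
    -- A commuting pair generates an abelian subgroup, on which coboundaries are symmetric.
    have hcomm : IsMulCommutative (Subgroup.closure {g, h}) :=
      Subgroup.isMulCommutative_closure (by
        rintro a (rfl | rfl) b (rfl | rfl)
        exacts [rfl, hgh.eq, hgh.eq.symm, rfl])
    obtain ⟨f, hf⟩ := (resH2_H2π_eq_zero_iff G _ x).1 (H _ hcomm)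
    have hg : g ∈ Subgroup.closure {g, h} := Subgroup.subset_closure (by simp)
    have hh : h ∈ Subgroup.closure {g, h} := Subgroup.subset_closure (by simp)
    apply ULift.down_injective
    refine (hf ⟨g, hg⟩ ⟨h, hh⟩).trans (Eq.trans ?_ (hf ⟨h, hh⟩ ⟨g, hg⟩).symm)
    rw [mul_comm (⟨g, hg⟩ : Subgroup.closure {g, h})]
    abel
  · intro H A hA
    exact (resH2_H2π_eq_zero_iff G A x).2 <| exists_coboundary_of_symmetric
      (fun a b : A => (show ULift.{u} (AddCircle (1 : ℚ)) from x (a, b)).down)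
      (fun g h j => (mem_cocycles₂_ratModInt_iff G _).1 x.2 g h j)
      (fun g h => congrArg ULift.down (H g h (congrArg Subtype.val (mul_comm g h))))

theorem nonempty_bogomolovMultiplier_addEquiv :
    Nonempty (BogomolovClasses G ≃+ bogomolovMultiplier G) := by
  have hker : (characterCoboundary G).range.addSubgroupOf (bogomolovCocycles G) =
      (bogomolovCocycleClass G).ker := by
    ext c
    rw [AddMonoidHom.mem_ker, AddSubgroup.mem_addSubgroupOf, bogomolovCocycleClass_eq_zero_iff]
  have hrange : (bogomolovCocycleClass G).range = (bogomolovMultiplier G).toAddSubgroup := by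
    ext y
    constructor
    · rintro ⟨c, rfl⟩
      exact (H2π_mem_bogomolovMultiplier_iff G _).2
        fun g h hgh => congrArg ULift.up (c.2.2 g h hgh)
    · induction y using groupCohomology.H2_induction_on with | h x => ?_
      intro hx
      exact ⟨⟨fun g h => (show ULift.{u} (AddCircle (1 : ℚ)) from x (g, h)).down,
        (mem_cocycles₂_ratModInt_iff G _).1 x.2, fun g h hgh => congrArg ULift.down
          ((H2π_mem_bogomolovMultiplier_iff G x).1 hx g h hgh)⟩, rfl⟩
  exact ⟨((QuotientAddGroup.quotientAddEquivOfEq hker).trans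
    (QuotientAddGroup.quotientKerEquivRange _)).trans (AddEquiv.addSubgroupCongr hrange)⟩

end Multiplier

/-! ### Isoclinism and `B₀` -/

section IsoclinicMultiplier

variable {G₁ : Type u} {G₂ : Type v} [Group G₁] [Group G₂]

/-- The fibre product of two groups over an isomorphism of their central quotients. -/
def centralFibreProduct (α : G₁ ⧸ Subgroup.center G₁ ≃* G₂ ⧸ Subgroup.center G₂) :
    Subgroup (G₁ × G₂) :=
  ((α.toMonoidHom.comp (QuotientGroup.mk' (Subgroup.center G₁))).comp
    (MonoidHom.fst G₁ G₂)).eqLocus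
      ((QuotientGroup.mk' (Subgroup.center G₂)).comp (MonoidHom.snd G₁ G₂))

/-- The derived subgroup of the fibre product lies on the graph of the bijection `β`, so each
projection is injective on it. -/
theorem IsIsoclinism.apply_fst_eq_snd
    {α : G₁ ⧸ Subgroup.center G₁ ≃* G₂ ⧸ Subgroup.center G₂}
    {β : commutator G₁ ≃* commutator G₂} (h : IsIsoclinism α β)
    {p : centralFibreProduct α} (hp : p ∈ commutator (centralFibreProduct α)) :
    ∃ hp₁ : p.1.1 ∈ commutator G₁, (β ⟨p.1.1, hp₁⟩ : G₂) = p.1.2 := by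
  rw [commutator_eq_closure] at hp
  induction hp using Subgroup.closure_induction with
  | mem x hx =>
    obtain ⟨a, b, rfl⟩ := hx
    exact ⟨(derivedComm a.1.1 b.1.1).2,
      congrArg Subtype.val (h a.1.1 b.1.1 a.1.2 b.1.2 a.2 b.2)⟩
  | one => exact ⟨one_mem _, congrArg Subtype.val (map_one β)⟩
  | mul x y _ _ hx hy =>
    obtain ⟨hx₁, hx₂⟩ := hx
    obtain ⟨hy₁, hy₂⟩ := hy
    refine ⟨mul_mem hx₁ hy₁, (congrArg Subtype.val (map_mul β ⟨_, hx₁⟩ ⟨_, hy₁⟩)).trans ?_⟩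
    rw [Subgroup.coe_mul, hx₂, hy₂]
    rfl
  | inv x _ hx =>
    obtain ⟨hx₁, hx₂⟩ := hx
    refine ⟨inv_mem hx₁, (congrArg Subtype.val (map_inv β ⟨_, hx₁⟩)).trans ?_⟩
    rw [Subgroup.coe_inv, hx₂]
    rfl

theorem IsIsoclinism.nonempty_bogomolovMultiplier_addEquiv
    {α : G₁ ⧸ Subgroup.center G₁ ≃* G₂ ⧸ Subgroup.center G₂}
    {β : commutator G₁ ≃* commutator G₂} (h : IsIsoclinism α β) :
    Nonempty (bogomolovMultiplier G₁ ≃+ bogomolovMultiplier G₂) := by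
  have hs₁ : Function.Surjective
      ((MonoidHom.fst G₁ G₂).comp (centralFibreProduct α).subtype) := fun a => by
    obtain ⟨b, hb⟩ := QuotientGroup.mk_surjective (α a)
    exact ⟨⟨(a, b), hb.symm⟩, rfl⟩
  have hs₂ : Function.Surjective
      ((MonoidHom.snd G₁ G₂).comp (centralFibreProduct α).subtype) := fun b => by
    obtain ⟨a, ha⟩ := QuotientGroup.mk_surjective (α.symm b)
    exact ⟨⟨(a, b), (congrArg α ha).trans (α.apply_symm_apply _)⟩, rfl⟩
  obtain ⟨e₁⟩ := nonempty_bogomolovClasses_addEquiv hs₁ fun p hp hp' => by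
    obtain ⟨hp₁, hp₂⟩ := h.apply_fst_eq_snd hp'
    have h₁ : p.1.1 = 1 := hp
    have h₂ : (⟨p.1.1, hp₁⟩ : commutator G₁) = 1 := Subtype.ext h₁
    rw [h₂, map_one] at hp₂
    exact Subtype.ext (Prod.ext h₁ hp₂.symm)
  obtain ⟨e₂⟩ := nonempty_bogomolovClasses_addEquiv hs₂ fun p hp hp' => by
    obtain ⟨hp₁, hp₂⟩ := h.apply_fst_eq_snd hp'
    have h₁ : p.1.2 = 1 := hp
    have h₂ : (⟨p.1.1, hp₁⟩ : commutator G₁) = 1 :=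
      (map_eq_one_iff β β.injective).1 (Subtype.ext (hp₂.trans h₁))
    exact Subtype.ext (Prod.ext (congrArg Subtype.val h₂) h₁)
  obtain ⟨f₁⟩ := _root_.nonempty_bogomolovMultiplier_addEquiv G₁
  obtain ⟨f₂⟩ := _root_.nonempty_bogomolovMultiplier_addEquiv G₂
  exact ⟨((f₁.symm.trans e₁).trans e₂.symm).trans f₂⟩

end IsoclinicMultiplier

theorem theorem1p2 (G₁ : Type u) (G₂ : Type v) [Group G₁] [Group G₂] (h : Isoclinic G₁ G₂) :
    Nonempty (bogomolovTilde G₁ ≃* bogomolovTilde G₂) ∧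
      (Finite G₁ → Finite G₂ →
        Nonempty (bogomolovMultiplier G₁ ≃+ bogomolovMultiplier G₂)) := by
  obtain ⟨α, β, hαβ⟩ := h
  have hiso : IsIsoclinism α β := hαβ
  exact ⟨hiso.nonempty_bogomolovTilde_mulEquiv,
    fun _ _ => hiso.nonempty_bogomolovMultiplier_addEquiv⟩
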